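/- Let $\mathcal G$ be a two-player finite game in normal form: each player $k\in\{1,2\}$ has a nonempty finite set of actions $\mathcal A_k$ and a payoff function $u_k:\mathcal A_1\times\mathcal A_2\to\mathbb R$, extended multilinearly to the strategy space $\mathcal X=\mathcal X_1\times\mathcal X_2$, where $\mathcal X_k=\Delta(\mathcal A_k)$ is the simplex of mixed strategies. Let $v_k(x)=(u_k(\alpha;x_{-k}))_{\alpha\in\mathcal A_k}$ be the payoff vector of player $k$, where $u_k(\alpha;x_{-k})$ is the expected payoff of the action $\alpha$ against the opponent's mixed strategy, and let $\mathtt{br}_k(x)=\arg\max_{x_k'\in\mathcal X_k}\langle v_k(x)\,|\,x_k'\rangle$ and $\mathtt{br}(x)=\mathtt{br}_1(x)\times\mathtt{br}_2(x)$. For each $k$, let $h_k:\mathcal X_k\to\mathbb R$ be a penalty function, that is, a function that is continuous and strongly convex on $\mathcal X_k$ and smooth on the relative interior of every face of $\mathcal X_k$, and let $Q_k(y_k)=\arg\max_{x_k\in\mathcal X_k}\{\langle y_k|x_k\rangle-h_k(x_k)\}$ be the induced choice map on $\mathbb R^{\mathcal A_k}$. Let $x(t)=Q(y(t))$, $t\ge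 0$, be an orbit of the reinforcement learning process $$y_k(t)=y_k(0)+\int_0^t v_k(x(s))\,ds,\qquad x_k(t)=Q_k(y_k(t)),\qquad k=1,2,\tag{RL}$$ with arbitrary initial scores $y_k(0)\in\mathbb R^{\mathcal A_k}$, and let $\bar x(t)=t^{-1}\int_0^t x(s)\,ds$ be its time average. **Theorem.** The $\omega$-limit set $L=\bigcap_{T}\overline{\{\bar x(t):t\ge T\}}$ is internally chain transitive under the best response dynamics $\dot x\in\mathtt{br}(x)-x$. That is, $L$ is nonempty and compact, and for all $p,q\in L$, $\varepsilon>0$ and $T>0$ there are an integer $n\ge1$, solutions $z_1,\dots,z_n:\mathbb R\to\mathcal X$ of the best response dynamics (locally absolutely continuous curves with $\dot z_i(t)\in\mathtt{br}(z_i(t))-z_i(t)$ for almost every $t$) and times $\tau_1,\dots,\tau_n>T$ such that $z_i(s)\in L$ for all $s\in[0,\tau_i]$ and all $i$, $\|z_i(\tau_i)-z_{i+1}(0)\|\le\varepsilon$ for $1\le i<n$, $\|z_1(0)-p\|\le\varepsilon$ and $\|z_n(\tau_n)-q\|\le\varepsilon$. -/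

import Mathlib

open MeasureTheory Set Filter Topology
open scoped ContDiff

noncomputable section

/-- The set of maximizers of `f` over the set `s`. -/
def argmaxSet {E : Type*} (f : E → ℝ) (s : Set E) : Set E :=
  {x | x ∈ s ∧ ∀ z ∈ s, f z ≤ f x}

/-! ### Penalty functions and choice maps -/

/-- The relative interior of the face of the simplex `Δ(A)` spanned by the actions in `S`:
the mixed strategies whose support is exactly `S`. -/
def openFace {A : Type*} [Fintype A] (S : Set A) : Set (A → ℝ) :=
  {x | x ∈ stdSimplex ℝ A ∧ ∀ a, 0 < x a ↔ a ∈ S}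

/-- The duality pairing between score vectors and mixed strategies. -/
def pairing {A : Type*} [Fintype A] (y x : A → ℝ) : ℝ := ∑ a, y a * x a

/-- Penalty functions on the simplex `Δ(A)`; only the values of `toFun` on the simplex matter.
Smoothness on the relative interior of a face means smoothness along every smooth curve that
stays in this relative interior. The choice of norm in the strong convexity condition is
immaterial, as the modulus `K` is arbitrary. -/
structure PenaltyFunction (A : Type*) [Fintype A] where
  /-- The underlying function. -/
  toFun : (A → ℝ) → ℝ
  continuousOn : ContinuousOn toFun (stdSimplex ℝ A)
  smooth_faces : ∀ (S : Set A) (ε : ℝ), 0 < ε → ∀ γ : ℝ → A → ℝ,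
    ContDiffOn ℝ ∞ γ (Ioo (-ε) ε) → (∀ t ∈ Ioo (-ε) ε, γ t ∈ openFace S) →
    ContDiffOn ℝ ∞ (fun t => toFun (γ t)) (Ioo (-ε) ε)
  strongConvex : ∃ K : ℝ, 0 < K ∧ StrongConvexOn (stdSimplex ℝ A) K toFun

/-- The regularized maximization problem defining the choice map has a unique solution. -/
theorem PenaltyFunction.existsUnique_argmax {A : Type*} [Fintype A] [Nonempty A]
    (h : PenaltyFunction A) (y : A → ℝ) :
    ∃! x : A → ℝ, x ∈ argmaxSet (fun z => pairing y z - h.toFun z) (stdSimplex ℝ A) := by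
  classical
  obtain ⟨K, hK, hconv⟩ := h.strongConvex
  have hne : (stdSimplex ℝ A).Nonempty :=
    ⟨_, single_mem_stdSimplex ℝ (Classical.arbitrary A)⟩
  have hcont : ContinuousOn (fun z => pairing y z - h.toFun z) (stdSimplex ℝ A) := by
    refine ContinuousOn.sub ?_ h.continuousOn
    unfold pairing
    fun_prop
  obtain ⟨x, hx, hmax⟩ := (isCompact_stdSimplex ℝ A).exists_isMaxOn hne hcont
  refine ⟨x, ⟨hx, fun z hz => hmax hz⟩, ?_⟩
  rintro x' ⟨hx', hmax'⟩
  by_contra hneq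
  have hpos : 0 < ‖x' - x‖ := norm_pos_iff.2 (sub_ne_zero.2 hneq)
  have hhalf : (0 : ℝ) ≤ 1 / 2 := by norm_num
  have hsum : (1 / 2 : ℝ) + 1 / 2 = 1 := by norm_num
  have hmid := hconv.2 hx' hx hhalf hhalf hsum
  have hmem := hconv.1 hx' hx hhalf hhalf hsum
  have h1 := hmax' _ hmem
  have h2 : pairing y x - h.toFun x ≤ pairing y x' - h.toFun x' := hmax' _ hx
  have hlin : pairing y ((1 / 2 : ℝ) • x' + (1 / 2 : ℝ) • x)
      = 1 / 2 * pairing y x' + 1 / 2 * pairing y x := by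
    simp only [pairing, Pi.add_apply, Pi.smul_apply, smul_eq_mul, Finset.mul_sum,
      ← Finset.sum_add_distrib]
    exact Finset.sum_congr rfl fun a _ => by ring
  have h3 : pairing y x' - h.toFun x' ≤ pairing y x - h.toFun x := hmax hx'
  simp only [smul_eq_mul] at hmid h1
  rw [hlin] at h1
  have hKp : 0 < K * ‖x' - x‖ ^ 2 := by positivity
  nlinarith

/-- The choice map (regularized argmax) `Q(y) = argmax_{x ∈ Δ(A)} (⟨y|x⟩ - h(x))`. -/
def choiceMap {A : Type*} [Fintype A] [Nonempty A] (h : PenaltyFunction A) (y : A → ℝ) :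
    A → ℝ :=
  (h.existsUnique_argmax y).choose

theorem choiceMap_mem {A : Type*} [Fintype A] [Nonempty A] (h : PenaltyFunction A)
    (y : A → ℝ) :
    choiceMap h y ∈ argmaxSet (fun z => pairing y z - h.toFun z) (stdSimplex ℝ A) :=
  (h.existsUnique_argmax y).choose_spec.1

/-! ### Finite games in normal form, with players `ι` and action sets `A k`

A game is given by its payoff functions `u k : (∏ j, A j) → ℝ`. -/

/-- The strategy space `𝒳 = ∏ k, Δ(A k)`. -/
def strategySpace {ι : Type*} (A : ι → Type*) [∀ k, Fintype (A k)] : Set (∀ k, A k → ℝ) :=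
  {x | ∀ k, x k ∈ stdSimplex ℝ (A k)}

/-- The expected payoff `u_k(x)` of player `k` at the mixed strategy profile `x`. -/
def expectedPayoff {ι : Type*} [Fintype ι] [DecidableEq ι] {A : ι → Type*}
    [∀ k, Fintype (A k)] (u : ι → (∀ k, A k) → ℝ) (k : ι) (x : ∀ k, A k → ℝ) : ℝ :=
  ∑ a : (∀ j, A j), u k a * ∏ j, x j (a j)

open scoped Classical in
/-- The payoff vector `v_k(x) = (u_k(α; x_{-k}))_α` of player `k` at `x`. -/
def payoffVector {ι : Type*} [Fintype ι] [DecidableEq ι] {A : ι → Type*}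
    [∀ k, Fintype (A k)] (u : ι → (∀ k, A k) → ℝ) (k : ι) (x : ∀ k, A k → ℝ) : A k → ℝ :=
  fun α => expectedPayoff u k (Function.update x k (Pi.single α 1))

/-- The best response correspondence `br_k(x) = argmax_{x' ∈ Δ(A k)} ⟨v_k(x)|x'⟩`. -/
def bestResponse {ι : Type*} [Fintype ι] [DecidableEq ι] {A : ι → Type*}
    [∀ k, Fintype (A k)] (u : ι → (∀ k, A k) → ℝ) (k : ι) (x : ∀ k, A k → ℝ) :
    Set (A k → ℝ) :=
  argmaxSet (pairing (payoffVector u k x)) (stdSimplex ℝ (A k))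

/-- The set-valued field of the best response dynamics, `br(x) - x`. -/
def bestResponseField {ι : Type*} [Fintype ι] [DecidableEq ι] {A : ι → Type*}
    [∀ k, Fintype (A k)] (u : ι → (∀ k, A k) → ℝ) (x : ∀ k, A k → ℝ) :
    Set (∀ k, A k → ℝ) :=
  {w | ∀ k, ∃ b ∈ bestResponse u k x, w k = b - x k}

/-! ### Reinforcement learning -/

/-- The trajectory of play `x(t) = Q(y(t))` induced by the score trajectory `y`. -/
def play {ι : Type*} {A : ι → Type*} [∀ k, Fintype (A k)] [∀ k, Nonempty (A k)]
    (h : ∀ k, PenaltyFunction (A k)) (y : ℝ → ∀ k, A k → ℝ) : ℝ → ∀ k, A k → ℝ :=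
  fun t k => choiceMap (h k) (y t k)

/-- `y` solves the reinforcement learning process: for all `t ≥ 0` and every player `k`,
`y_k(t) = y_k(0) + ∫₀ᵗ v_k(x(s)) ds`, where `x(s) = Q(y(s))`. -/
def IsReinforcementSolution {ι : Type*} [Fintype ι] [DecidableEq ι] {A : ι → Type*}
    [∀ k, Fintype (A k)] [∀ k, Nonempty (A k)] (u : ι → (∀ k, A k) → ℝ)
    (h : ∀ k, PenaltyFunction (A k)) (y : ℝ → ∀ k, A k → ℝ) : Prop :=
  ∀ t, 0 ≤ t → ∀ k,
    IntervalIntegrable (fun s => payoffVector u k (play h y s)) volume 0 t ∧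
      y t k = y 0 k + ∫ s in (0 : ℝ)..t, payoffVector u k (play h y s)

/-- The time average `t⁻¹ ∫₀ᵗ x(s) ds` (for `t > 0`). -/
def timeAverage {E : Type*} [NormedAddCommGroup E] [NormedSpace ℝ E] (x : ℝ → E) : ℝ → E :=
  fun t => t⁻¹ • ∫ s in (0 : ℝ)..t, x s

/-- The `ω`-limit set `⋂_T closure {c(t) : t ≥ T}` of a curve `c`. -/
def omegaLimitSet {E : Type*} [TopologicalSpace E] (c : ℝ → E) : Set E :=
  ⋂ T : ℝ, closure (c '' Ici T)

/-! ### Differential inclusions -/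

/-- `z` is a (complete) solution in the state space `X` of the differential inclusion
`ż ∈ F(z)`: it is `X`-valued, absolutely continuous on compact intervals, and satisfies the
inclusion at almost every time. -/
def IsInclusionSolution {E : Type*} [NormedAddCommGroup E] [NormedSpace ℝ E]
    (F : E → Set E) (X : Set E) (z : ℝ → E) : Prop :=
  (∀ t, z t ∈ X) ∧ (∀ a b, AbsolutelyContinuousOnInterval z a b) ∧
    ∀ᵐ t, ∃ w ∈ F (z t), HasDerivAt z w t

/-- There is an `(ε, T)`-chain in `L` from `p` to `q`: finitely many pieces
`z i : [0, τ i] → L` of solutions, each of duration `τ i > T`, with jumps of size at most `ε`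
from `p` to the first piece, between consecutive pieces, and from the last piece to `q`. -/
def HasChain {E : Type*} [NormedAddCommGroup E] [NormedSpace ℝ E]
    (F : E → Set E) (X L : Set E) (ε T : ℝ) (p q : E) : Prop :=
  ∃ (m : ℕ) (z : Fin (m + 1) → ℝ → E) (τ : Fin (m + 1) → ℝ),
    (∀ i, IsInclusionSolution F X (z i)) ∧ (∀ i, T < τ i) ∧
    (∀ i, ∀ s ∈ Icc 0 (τ i), z i s ∈ L) ∧
    (∀ i : Fin m, ‖z i.castSucc (τ i.castSucc) - z i.succ 0‖ ≤ ε) ∧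
    ‖z 0 0 - p‖ ≤ ε ∧ ‖z (Fin.last m) (τ (Fin.last m)) - q‖ ≤ ε

/-- `L` is internally chain transitive for `ż ∈ F(z)` on the state space `X`: it is a nonempty
compact set any two points of which are joined by `(ε, T)`-chains in `L`, for all
`ε, T > 0`. -/
def IsInternallyChainTransitive {E : Type*} [NormedAddCommGroup E] [NormedSpace ℝ E]
    (F : E → Set E) (X L : Set E) : Prop :=
  L.Nonempty ∧ IsCompact L ∧
    ∀ p ∈ L, ∀ q ∈ L, ∀ ε : ℝ, 0 < ε → ∀ T : ℝ, 0 < T → HasChain F X L ε T p q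

end

/-!
The time average `c` of play is, in logarithmic time, a perturbed solution of the best response
dynamics: with two players the payoff vector is linear in the profile, so the score at time `t` is
`y 0 + t • v (c t)`, and since the penalties are bounded, play at time `t` is a `C / t`-best
response to `c t` (`IsReinforcementSolution.exists_play_mem_approxBestResponse`). The rest of the
argument uses only this (`IsAveragedResponse`).

The translates `r ↦ c (t e ^ r)` are equi-Lipschitz with values in a compact set, so they converge
locally uniformly along every ultrafilter `t → ∞`. Such a limit `z` stays in the limit set. It also
solves the best response dynamics: `e ^ r c (t e ^ r)` is an integral of play, so for `δ > 0` the
quotient `(e ^ δ z (r + δ) - z r) / (e ^ δ - 1)` lies in the closed convex set of `O(δ)`-best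
responses to `z r` (`exists_slope_mem`); where `z` is differentiable, `δ → 0` shows that
`z' r + z r` is a best response to `z r`. No weak compactness of derivatives is needed.

By contradiction, on a window of fixed logarithmic length `c` is eventually uniformly close to such
a solution (`eventually_exists_solution`). Given `p` and `q` in the limit set, pick late times
`a < b` at which `c` is near `p` and `q`, cut `[a, b]` into logarithmically equal pieces of length
between `T + 1` and `2 (T + 1)`, and replace `c` on each piece by a nearby solution: these solutions
form the chain (`hasChain`).
-/

/-! ### The choice map -/

/-- The choice map is continuous: limits of regularized maximizers are regularized maximizers,
which are unique. -/
theorem continuous_choiceMap {A : Type*} [Fintype A] [Nonempty A] (h : PenaltyFunction A) :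
    Continuous (choiceMap h) := by
  rw [continuous_iff_ultrafilter]
  intro y g hg
  have hmem : ∀ z, choiceMap h z ∈ stdSimplex ℝ A := fun z => (choiceMap_mem h z).1
  obtain ⟨x, hx, hlim⟩ := (isCompact_stdSimplex ℝ A).ultrafilter_le_nhds (g.map (choiceMap h))
    (tendsto_principal.2 (Eventually.of_forall hmem))
  have hlim' : Tendsto (choiceMap h) g (𝓝 x) := hlim
  have hid : Tendsto (fun z : A → ℝ => z) g (𝓝 y) := hg
  have hh : Tendsto (fun z => h.toFun (choiceMap h z)) g (𝓝 (h.toFun x)) :=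
    (h.continuousOn x hx).tendsto.comp
      (tendsto_nhdsWithin_iff.2 ⟨hlim', Eventually.of_forall hmem⟩)
  have hpair : Continuous fun p : (A → ℝ) × (A → ℝ) => pairing p.1 p.2 := by
    unfold pairing; fun_prop
  have hx' : x ∈ argmaxSet (fun z => pairing y z - h.toFun z) (stdSimplex ℝ A) := by
    refine ⟨hx, fun z hz => ?_⟩
    refine le_of_tendsto_of_tendsto (b := (g : Filter (A → ℝ)))
      (f := fun y' => pairing y' z - h.toFun z)
      (g := fun y' => pairing y' (choiceMap h y') - h.toFun (choiceMap h y')) ?_ ?_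
      (Eventually.of_forall fun y' => (choiceMap_mem h y').2 z hz)
    · exact ((hpair.tendsto (y, z)).comp (hid.prodMk_nhds tendsto_const_nhds)).sub
        tendsto_const_nhds
    · exact ((hpair.tendsto (y, x)).comp (hid.prodMk_nhds hlim')).sub hh
  rw [(h.existsUnique_argmax y).unique (choiceMap_mem h y) hx']
  exact hlim'

/-! ### Payoffs and best responses in two-player games -/

theorem pairing_add_left {A : Type*} [Fintype A] (y y' x : A → ℝ) :
    pairing (y + y') x = pairing y x + pairing y' x := by
  simp [pairing, add_mul, Finset.sum_add_distrib]

theorem pairing_smul_left {A : Type*} [Fintype A] (r : ℝ) (y x : A → ℝ) :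
    pairing (r • y) x = r * pairing y x := by
  simp [pairing, mul_assoc, Finset.mul_sum]

theorem pairing_sub_left {A : Type*} [Fintype A] (y y' x : A → ℝ) :
    pairing (y - y') x = pairing y x - pairing y' x := by
  simp [pairing, sub_mul, Finset.sum_sub_distrib]

theorem pairing_add_right {A : Type*} [Fintype A] (y x x' : A → ℝ) :
    pairing y (x + x') = pairing y x + pairing y x' := by
  simp [pairing, mul_add, Finset.sum_add_distrib]

theorem pairing_smul_right {A : Type*} [Fintype A] (r : ℝ) (y x : A → ℝ) :
    pairing y (r • x) = r * pairing y x := by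
  simp [pairing, mul_left_comm, Finset.mul_sum]

theorem continuous_pairing_right {A : Type*} [Fintype A] (y : A → ℝ) :
    Continuous (pairing y) := by
  unfold pairing; fun_prop

theorem abs_pairing_le {A : Type*} [Fintype A] (y : A → ℝ) {x : A → ℝ}
    (hx : x ∈ stdSimplex ℝ A) : |pairing y x| ≤ ‖y‖ := by
  calc |pairing y x| ≤ ∑ a, |y a * x a| := Finset.abs_sum_le_sum_abs _ _
    _ ≤ ∑ a, ‖y‖ * x a := by
        refine Finset.sum_le_sum fun a _ => ?_
        rw [abs_mul, abs_of_nonneg (hx.1 a)]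
        exact mul_le_mul_of_nonneg_right (norm_le_pi_norm y a) (hx.1 a)
    _ = ‖y‖ := by rw [← Finset.mul_sum, hx.2, mul_one]

section TwoPlayers

variable {A : Fin 2 → Type*} [∀ k, Fintype (A k)]

/-- With two players the payoff vector of a player depends only on the strategy of the single
opponent, hence is linear in the strategy profile. -/
theorem isLinearMap_payoffVector (u : Fin 2 → (∀ k, A k) → ℝ) (k : Fin 2) :
    IsLinearMap ℝ (payoffVector u k) := by
  classical
  constructor
  · intro x x'
    ext α
    simp only [payoffVector, expectedPayoff, Pi.add_apply, ← Finset.sum_add_distrib]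
    refine Finset.sum_congr rfl fun a _ => ?_
    fin_cases k <;> simp [Fin.prod_univ_two, Function.update_of_ne] <;> ring
  · intro r x
    ext α
    simp only [payoffVector, expectedPayoff, Pi.smul_apply, smul_eq_mul, Finset.mul_sum]
    refine Finset.sum_congr rfl fun a _ => ?_
    fin_cases k <;> simp [Fin.prod_univ_two, Function.update_of_ne] <;> ring

/-- The payoff vector of a player in a two-player game, as a continuous linear map of the
strategy profile. -/
noncomputable def payoffCLM (u : Fin 2 → (∀ k, A k) → ℝ) (k : Fin 2) :
    (∀ k, A k → ℝ) →L[ℝ] (A k → ℝ) :=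
  LinearMap.toContinuousLinearMap (IsLinearMap.mk' _ (isLinearMap_payoffVector u k))

@[simp] theorem payoffCLM_apply (u : Fin 2 → (∀ k, A k) → ℝ) (k : Fin 2) (x : ∀ k, A k → ℝ) :
    payoffCLM u k x = payoffVector u k x := rfl

/-- The profiles of `η`-best responses to `x`: against `x`, no player can gain more than `η` by
deviating to another mixed strategy. -/
def approxBestResponse (u : Fin 2 → (∀ k, A k) → ℝ) (η : ℝ) (x : ∀ k, A k → ℝ) :
    Set (∀ k, A k → ℝ) :=
  {b | ∀ k, b k ∈ stdSimplex ℝ (A k) ∧ ∀ z ∈ stdSimplex ℝ (A k),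
    pairing (payoffVector u k x) z ≤ pairing (payoffVector u k x) (b k) + η}

theorem convex_approxBestResponse (u : Fin 2 → (∀ k, A k) → ℝ) (η : ℝ) (x : ∀ k, A k → ℝ) :
    Convex ℝ (approxBestResponse u η x) := by
  intro b hb b' hb' s t hs ht hst k
  refine ⟨convex_stdSimplex ℝ (A k) (hb k).1 (hb' k).1 hs ht hst, fun z hz => ?_⟩
  have h1 := mul_le_mul_of_nonneg_left ((hb k).2 z hz) hs
  have h2 := mul_le_mul_of_nonneg_left ((hb' k).2 z hz) ht
  rw [Pi.add_apply, Pi.smul_apply, Pi.smul_apply, pairing_add_right, pairing_smul_right,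
    pairing_smul_right]
  have ht' : t = 1 - s := by linarith
  subst ht'
  linarith

theorem isClosed_approxBestResponse (u : Fin 2 → (∀ k, A k) → ℝ) (η : ℝ)
    (x : ∀ k, A k → ℝ) : IsClosed (approxBestResponse u η x) := by
  simp only [approxBestResponse, ofPred_forall, ofPred_and]
  refine isClosed_iInter fun k => ((isClosed_stdSimplex ℝ (A k)).preimage
    (continuous_apply k)).inter (isClosed_iInter fun z => isClosed_iInter fun _ => ?_)
  exact isClosed_le continuous_const
    (((continuous_pairing_right _).comp (continuous_apply k)).add continuous_const)

theorem approxBestResponse_mono (u : Fin 2 → (∀ k, A k) → ℝ) {η η' : ℝ} (hη : η ≤ η')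
    (x : ∀ k, A k → ℝ) : approxBestResponse u η x ⊆ approxBestResponse u η' x :=
  fun _ hb k => ⟨(hb k).1, fun z hz => ((hb k).2 z hz).trans (by linarith)⟩

/-- Approximate best responses to `x` are approximate best responses to nearby profiles. -/
theorem exists_approxBestResponse_subset (u : Fin 2 → (∀ k, A k) → ℝ) :
    ∃ M : ℝ, 0 ≤ M ∧ ∀ η x x',
      approxBestResponse u η x ⊆ approxBestResponse u (η + M * ‖x - x'‖) x' := by
  refine ⟨2 * ∑ k, ‖payoffCLM u k‖, by positivity, fun η x x' b hb k => ⟨(hb k).1, ?_⟩⟩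
  intro z hz
  have h1 := (hb k).2 z hz
  have hv : payoffVector u k x - payoffVector u k x' = payoffCLM u k (x - x') := by
    rw [map_sub]; rfl
  have hn : ‖payoffVector u k x - payoffVector u k x'‖
      ≤ (∑ k, ‖payoffCLM u k‖) * ‖x - x'‖ := by
    rw [hv]
    refine ((payoffCLM u k).le_opNorm _).trans (mul_le_mul_of_nonneg_right ?_ (norm_nonneg _))
    exact Finset.single_le_sum (f := fun k => ‖payoffCLM u k‖) (fun _ _ => norm_nonneg _)
      (Finset.mem_univ k)
  have h2 := (abs_le.1 (abs_pairing_le (payoffVector u k x - payoffVector u k x') hz)).1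
  have h3 := (abs_le.1 (abs_pairing_le (payoffVector u k x - payoffVector u k x') (hb k).1)).2
  rw [pairing_sub_left] at h2 h3
  linarith

theorem sub_mem_bestResponseField (u : Fin 2 → (∀ k, A k) → ℝ) {b x : ∀ k, A k → ℝ}
    (hb : ∀ η, 0 < η → b ∈ approxBestResponse u η x) : b - x ∈ bestResponseField u x :=
  fun k => ⟨b k, ⟨(hb 1 one_pos k).1, fun z hz =>
    le_of_forall_pos_le_add fun η hη => (hb η hη k).2 z hz⟩, rfl⟩

end TwoPlayers

/-! ### Time averages -/

section TimeAverage

variable {E : Type*} [NormedAddCommGroup E] [NormedSpace ℝ E]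

theorem smul_timeAverage (x : ℝ → E) {t : ℝ} (ht : t ≠ 0) :
    t • timeAverage x t = ∫ s in (0 : ℝ)..t, x s := by
  rw [timeAverage, smul_smul, mul_inv_cancel₀ ht, one_smul]

theorem inv_smul_integral_mem [CompleteSpace E] {x : ℝ → E} {B : Set E} (hB : Convex ℝ B)
    (hBc : IsClosed B) {a b : ℝ} (hab : a < b) (hx : ContinuousOn x (Icc a b))
    (hxB : ∀ s ∈ Ioc a b, x s ∈ B) :
    (b - a)⁻¹ • ∫ s in a..b, x s ∈ B := by
  rw [← interval_average_eq, uIoc_of_le hab.le]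
  refine hB.set_average_mem hBc (by simp [hab]) (by simp) ?_
    (hx.integrableOn_Icc.mono_set Ioc_subset_Icc_self)
  exact ae_restrict_of_forall_mem measurableSet_Ioc hxB

/-- The mean of `x` over `[a, b]` in terms of the time averages at `a` and `b`. -/
theorem timeAverage_diff_mem [CompleteSpace E] {x : ℝ → E} {B : Set E} (hB : Convex ℝ B)
    (hBc : IsClosed B) {a b : ℝ} (ha : 0 < a) (hab : a < b) (hx : ContinuousOn x (Ici 0))
    (hxB : ∀ s ∈ Ioc a b, x s ∈ B) :
    (b - a)⁻¹ • (b • timeAverage x b - a • timeAverage x a) ∈ B := by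
  have hint : ∀ c, 0 < c → IntervalIntegrable x volume 0 c := fun c hc =>
    (hx.mono (by rw [uIcc_of_le hc.le]; exact Icc_subset_Ici_self)).intervalIntegrable
  rw [smul_timeAverage x ha.ne', smul_timeAverage x (ha.trans hab).ne',
    intervalIntegral.integral_interval_sub_left (hint b (ha.trans hab)) (hint a ha)]
  exact inv_smul_integral_mem hB hBc hab (hx.mono fun s hs => ha.le.trans hs.1) hxB

theorem timeAverage_mem [CompleteSpace E] {x : ℝ → E} {B : Set E} (hB : Convex ℝ B)
    (hBc : IsClosed B) {t : ℝ} (ht : 0 < t) (hx : ContinuousOn x (Ici 0))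
    (hxB : ∀ s, 0 ≤ s → x s ∈ B) : timeAverage x t ∈ B := by
  have := inv_smul_integral_mem hB hBc ht (hx.mono Icc_subset_Ici_self)
    fun s hs => hxB s hs.1.le
  rwa [sub_zero] at this

/-- In logarithmic time, time averages move with speed at most the diameter of the range. -/
theorem norm_timeAverage_sub_le [CompleteSpace E] {x : ℝ → E} {X : Set E} (hX : Convex ℝ X)
    (hXc : IsClosed X) {D : ℝ} (hD0 : 0 ≤ D) (hD : ∀ p ∈ X, ∀ q ∈ X, ‖p - q‖ ≤ D)
    (hx : ContinuousOn x (Ici 0)) (hxX : ∀ s, 0 ≤ s → x s ∈ X) {a b : ℝ} (ha : 0 < a)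
    (hab : a ≤ b) :
    ‖timeAverage x b - timeAverage x a‖ ≤ D * (Real.log b - Real.log a) := by
  rcases hab.eq_or_lt with rfl | hab
  · simp
  have hb := ha.trans hab
  have hba : b - a ≠ 0 := (sub_pos.2 hab).ne'
  have hm := timeAverage_diff_mem hX hXc ha hab hx fun s hs => hxX s (ha.le.trans hs.1.le)
  set m := (b - a)⁻¹ • (b • timeAverage x b - a • timeAverage x a) with hmdef
  have hm' : (b - a) • m = b • timeAverage x b - a • timeAverage x a := by
    rw [hmdef, smul_inv_smul₀ hba]
  have hdiff : timeAverage x b - timeAverage x a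
      = (1 - (b / a)⁻¹) • (m - timeAverage x a) := by
    have hbm : timeAverage x b = b⁻¹ • ((b - a) • m + a • timeAverage x a) := by
      rw [hm', sub_add_cancel, inv_smul_smul₀ hb.ne']
    have hc : 1 - (b / a)⁻¹ = b⁻¹ * (b - a) := by field_simp
    rw [hbm, hc, smul_add, smul_smul, smul_smul, smul_sub, mul_sub (b⁻¹), inv_mul_cancel₀ hb.ne']
    module
  have hlog := Real.one_sub_inv_le_log_of_pos (div_pos hb ha)
  rw [Real.log_div hb.ne' ha.ne'] at hlog
  have hnn : 0 ≤ 1 - (b / a)⁻¹ := by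
    rw [inv_div, sub_nonneg, div_le_one hb]; exact hab.le
  rw [hdiff, norm_smul, Real.norm_of_nonneg hnn, mul_comm]
  exact mul_le_mul (hD _ hm _ (timeAverage_mem hX hXc ha hx hxX)) hlog hnn hD0

end TimeAverage

/-! ### Limits of translates in logarithmic time -/

theorem log_mul_exp_sub {t : ℝ} (ht : 0 < t) (r s : ℝ) :
    Real.log (t * Real.exp r) - Real.log (t * Real.exp s) = r - s := by
  rw [Real.log_mul ht.ne' (Real.exp_pos _).ne', Real.log_mul ht.ne' (Real.exp_pos _).ne',
    Real.log_exp, Real.log_exp]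
  ring

section Translates

variable {E : Type*} [NormedAddCommGroup E]

theorem mem_omegaLimitSet_of_tendsto {c : ℝ → E} {U : Filter ℝ} [U.NeBot] {g : ℝ → ℝ} {p : E}
    (hg : Tendsto g U atTop) (h : Tendsto (fun t => c (g t)) U (𝓝 p)) : p ∈ omegaLimitSet c := by
  refine mem_iInter.2 fun T => mem_closure_of_tendsto h ?_
  filter_upwards [hg.eventually_ge_atTop T] with t ht
  exact mem_image_of_mem c ht

theorem exists_gt_near_of_mem_omegaLimitSet {c : ℝ → E} {p : E} (hp : p ∈ omegaLimitSet c)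
    {ε : ℝ} (hε : 0 < ε) (T : ℝ) : ∃ t, T ≤ t ∧ ‖c t - p‖ ≤ ε := by
  obtain ⟨_, ⟨t, ht, rfl⟩, hd⟩ := Metric.mem_closure_iff.1 (mem_iInter.1 hp T) ε hε
  rw [dist_comm, dist_eq_norm] at hd
  exact ⟨t, ht, hd.le⟩

/-- Pointwise limits of equi-Lipschitz curves are uniform limits on bounded intervals. -/
theorem eventually_forall_norm_sub_le {U : Filter ℝ} {f : ℝ → ℝ → E} {z : ℝ → E} {D : ℝ}
    (hD : 0 ≤ D) (hf : ∀ᶠ t in U, ∀ r s, 0 ≤ r → 0 ≤ s → ‖f t r - f t s‖ ≤ D * |r - s|)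
    (hz : ∀ r s, ‖z r - z s‖ ≤ D * |r - s|) (hlim : ∀ r, Tendsto (fun t => f t r) U (𝓝 (z r)))
    {ε : ℝ} (hε : 0 < ε) (R : ℝ) : ∀ᶠ t in U, ∀ r ∈ Icc 0 R, ‖f t r - z r‖ ≤ ε := by
  have hδ : 0 < ε / (3 * (D + 1)) := by positivity
  obtain ⟨N, hNs, hN, hcov⟩ := finite_cover_balls_of_compact (isCompact_Icc (a := 0) (b := R)) hδ
  have hgrid : ∀ᶠ t in U, ∀ s ∈ N, ‖f t s - z s‖ < ε / 3 := by
    rw [hN.eventually_all]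
    intro s _
    have := (Metric.tendsto_nhds.1 (hlim s)) (ε / 3) (by positivity)
    simpa only [dist_eq_norm] using this
  filter_upwards [hgrid, hf] with t ht hft r hr
  obtain ⟨s, hs, hrs⟩ := mem_iUnion₂.1 (hcov hr)
  rw [Metric.mem_ball, Real.dist_eq] at hrs
  have hDε : D * |r - s| ≤ ε / 3 := by
    calc D * |r - s| ≤ (D + 1) * (ε / (3 * (D + 1))) := by
          gcongr
          linarith
      _ = ε / 3 := by field_simp
  have h1 := hft r s hr.1 (hNs hs).1
  have h2 := hz s r
  rw [abs_sub_comm] at h2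
  have h3 := ht s hs
  calc ‖f t r - z r‖ = ‖(f t r - f t s) + (f t s - z s) + (z s - z r)‖ := by congr 1; abel
    _ ≤ ‖f t r - f t s‖ + ‖f t s - z s‖ + ‖z s - z r‖ := norm_add₃_le
    _ ≤ ε := by linarith

end Translates

/-! ### Averages of approximate responses -/

section AveragedInclusion

variable {E : Type*} [NormedAddCommGroup E] [NormedSpace ℝ E]

/-- The curve `x` takes its values in the compact convex set `X`, and `x t` is a
`C / t`-approximate response to the time average of `x` at `t`. Here `B η p` stands for the set of
`η`-approximate responses to `p`, with the structural properties of approximate best responses. -/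
structure IsAveragedResponse (X : Set E) (B : ℝ → E → Set E) (x : ℝ → E) : Prop where
  isCompact : IsCompact X
  convex : Convex ℝ X
  convex_response : ∀ η p, Convex ℝ (B η p)
  isClosed_response : ∀ η p, IsClosed (B η p)
  response_mono : ∀ η η' p, η ≤ η' → B η p ⊆ B η' p
  exists_response_subset : ∃ M : ℝ, 0 ≤ M ∧ ∀ η p q, B η p ⊆ B (η + M * ‖p - q‖) q
  continuousOn : ContinuousOn x (Ici 0)
  mem : ∀ s, 0 ≤ s → x s ∈ X
  exists_mem_response : ∃ C : ℝ, ∀ t, 0 < t → x t ∈ B (C / t) (timeAverage x t)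

namespace IsAveragedResponse

variable {X : Set E} {B : ℝ → E → Set E} {x : ℝ → E}

theorem timeAverage_mem [CompleteSpace E] (H : IsAveragedResponse X B x) {t : ℝ} (ht : 0 < t) :
    timeAverage x t ∈ X :=
  _root_.timeAverage_mem H.convex H.isCompact.isClosed ht H.continuousOn H.mem

/-- In logarithmic time, the time average is Lipschitz on all of `(0, ∞)`. -/
theorem exists_lipschitz [CompleteSpace E] (H : IsAveragedResponse X B x) :
    ∃ D : ℝ, 0 ≤ D ∧ ∀ a b, 0 < a → 0 < b →
      ‖timeAverage x b - timeAverage x a‖ ≤ D * |Real.log b - Real.log a| := by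
  refine ⟨Metric.diam X, Metric.diam_nonneg, fun a b ha hb => ?_⟩
  have hD : ∀ p ∈ X, ∀ q ∈ X, ‖p - q‖ ≤ Metric.diam X := fun p hp q hq => by
    rw [← dist_eq_norm]; exact Metric.dist_le_diam_of_mem H.isCompact.isBounded hp hq
  rcases le_total a b with hab | hab
  · rw [abs_of_nonneg (sub_nonneg.2 (Real.log_le_log ha hab))]
    exact norm_timeAverage_sub_le H.convex H.isCompact.isClosed Metric.diam_nonneg hD
      H.continuousOn H.mem ha hab
  · rw [norm_sub_rev, abs_sub_comm, abs_of_nonneg (sub_nonneg.2 (Real.log_le_log hb hab))]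
    exact norm_timeAverage_sub_le H.convex H.isCompact.isClosed Metric.diam_nonneg hD
      H.continuousOn H.mem hb hab

/-- Translates of the time average in logarithmic time converge pointwise along every
ultrafilter at infinity. -/
theorem exists_tendsto_ultrafilter [CompleteSpace E] (H : IsAveragedResponse X B x)
    {U : Ultrafilter ℝ} (hU : (U : Filter ℝ) ≤ atTop) :
    ∃ z : ℝ → E, ∀ r, z r ∈ X ∧
      Tendsto (fun t => timeAverage x (t * Real.exp r)) U (𝓝 (z r)) := by
  have key : ∀ r : ℝ, ∃ p ∈ X, Tendsto (fun t => timeAverage x (t * Real.exp r)) U (𝓝 p) := by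
    intro r
    refine H.isCompact.ultrafilter_le_nhds (U.map fun t => timeAverage x (t * Real.exp r))
      (tendsto_principal.2 ?_)
    have hpos : ∀ᶠ t in (U : Filter ℝ), 0 < t := (eventually_gt_atTop 0).filter_mono hU
    filter_upwards [hpos] with t ht
    exact H.timeAverage_mem (by positivity)
  choose z hz using key
  exact ⟨z, hz⟩

/-- The normalized increments of `e ^ r • z r`, for a limit `z` of translates, are limits of
averages of approximate responses to points near `z r`. -/
theorem exists_slope_mem [CompleteSpace E] (H : IsAveragedResponse X B x)
    {U : Ultrafilter ℝ} (hU : (U : Filter ℝ) ≤ atTop) {z : ℝ → E}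
    (hz : ∀ r, Tendsto (fun t => timeAverage x (t * Real.exp r)) U (𝓝 (z r))) :
    ∃ K : ℝ, ∀ r δ, 0 < δ →
      (Real.exp δ - 1)⁻¹ • (Real.exp δ • z (r + δ) - z r) ∈ B (K * δ) (z r) := by
  obtain ⟨D, hD0, hD⟩ := H.exists_lipschitz
  obtain ⟨M, hM0, hM⟩ := H.exists_response_subset
  obtain ⟨C, hC⟩ := H.exists_mem_response
  refine ⟨1 + M * (D + 1), fun r δ hδ => ?_⟩
  have hlim : Tendsto (fun t => (Real.exp δ - 1)⁻¹ • (Real.exp δ •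
      timeAverage x (t * Real.exp (r + δ)) - timeAverage x (t * Real.exp r))) U
      (𝓝 ((Real.exp δ - 1)⁻¹ • (Real.exp δ • z (r + δ) - z r))) :=
    (((hz (r + δ)).const_smul _).sub (hz r)).const_smul _
  refine (H.isClosed_response _ _).mem_of_tendsto hlim ?_
  -- Far out along `U`, every `x s` with `s ∈ (t e ^ r, t e ^ (r + δ)]` is an approximate response
  -- to `z r`: the time average moves by at most `D δ` on this stretch.
  have hpos : ∀ᶠ t in (U : Filter ℝ), 0 < t := (eventually_gt_atTop 0).filter_mono hU
  have hnear := (Metric.tendsto_nhds.1 (hz r)) δ hδ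
  have hlarge : ∀ᶠ t in (U : Filter ℝ), |C| / (δ * Real.exp r) ≤ t :=
    (eventually_ge_atTop _).filter_mono hU
  filter_upwards [hpos, hnear, hlarge] with t ht htz htC
  rw [dist_eq_norm] at htz
  have ha : 0 < t * Real.exp r := by positivity
  have hab : t * Real.exp r < t * Real.exp (r + δ) :=
    mul_lt_mul_of_pos_left (Real.exp_lt_exp.2 (by linarith)) ht
  have hmem := timeAverage_diff_mem (H.convex_response ((1 + M * (D + 1)) * δ) (z r))
    (H.isClosed_response _ _) ha hab H.continuousOn ?_
  · convert hmem using 1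
    have he : Real.exp δ - 1 ≠ 0 := (sub_pos.2 (Real.one_lt_exp_iff.2 hδ)).ne'
    have hba : t * Real.exp (r + δ) - t * Real.exp r = (t * Real.exp r) * (Real.exp δ - 1) := by
      rw [Real.exp_add]; ring
    rw [hba, mul_inv, Real.exp_add, ← mul_assoc, mul_smul (t * Real.exp r), ← smul_sub,
      smul_smul _ (t * Real.exp r)]
    congr 1
    field_simp
  · intro s hs
    have hs0 : 0 < s := ha.trans hs.1
    have hlog1 : Real.log (t * Real.exp r) ≤ Real.log s := Real.log_le_log ha hs.1.le
    have hlog2 : Real.log s ≤ Real.log (t * Real.exp (r + δ)) := Real.log_le_log hs0 hs.2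
    have hlog3 := log_mul_exp_sub ht (r + δ) r
    have h1 := hD _ s ha hs0
    rw [abs_of_nonneg (by linarith)] at h1
    have h2 : ‖timeAverage x s - z r‖ ≤ D * δ + δ := by
      have h3 : D * (Real.log s - Real.log (t * Real.exp r)) ≤ D * δ :=
        mul_le_mul_of_nonneg_left (by linarith) hD0
      have h4 := norm_sub_le_norm_sub_add_norm_sub (timeAverage x s)
        (timeAverage x (t * Real.exp r)) (z r)
      linarith
    have h3 : C / s ≤ δ := by
      rw [div_le_iff₀ hs0]
      rw [div_le_iff₀ (by positivity)] at htC
      nlinarith [le_abs_self C, hs.1]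
    refine H.response_mono _ _ _ ?_ (hM _ _ (z r) (hC s hs0))
    have := mul_le_mul_of_nonneg_left h2 hM0
    linarith

/-- Every limit of translates of the time average solves the limiting inclusion. -/
theorem isInclusionSolution [FiniteDimensional ℝ E] (H : IsAveragedResponse X B x)
    {F : E → Set E} (hF : ∀ p b, (∀ η, 0 < η → b ∈ B η p) → b - p ∈ F p)
    {U : Ultrafilter ℝ} (hU : (U : Filter ℝ) ≤ atTop) {z : ℝ → E}
    (hzX : ∀ r, z r ∈ X) {D : ℝ} (hD0 : 0 ≤ D) (hLip : ∀ r s, ‖z r - z s‖ ≤ D * |r - s|)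
    (hz : ∀ r, Tendsto (fun t => timeAverage x (t * Real.exp r)) U (𝓝 (z r))) :
    IsInclusionSolution F X z := by
  have : CompleteSpace E := FiniteDimensional.complete ℝ E
  have hlip : LipschitzWith D.toNNReal z := by
    refine LipschitzWith.of_dist_le_mul fun r s => ?_
    rw [dist_eq_norm, Real.dist_eq, Real.coe_toNNReal _ hD0]
    exact hLip r s
  refine ⟨hzX, fun a b => (hlip.lipschitzOnWith (s := uIcc a b)).absolutelyContinuousOnInterval,
    ?_⟩
  filter_upwards [hlip.ae_differentiableAt_real] with r hr
  obtain ⟨K, hK⟩ := H.exists_slope_mem hU hz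
  have hder := hr.hasDerivAt
  refine ⟨deriv z r, ?_, hder⟩
  suffices hb : ∀ η, 0 < η → deriv z r + z r ∈ B η (z r) by simpa using hF (z r) _ hb
  -- The increments converge to the derivative of `δ ↦ e ^ δ • z (r + δ)` at `0`.
  have hshift : HasDerivAt (fun δ => z (r + δ)) (deriv z r) 0 := by
    have h0 : HasDerivAt z (deriv z r) (r + 0) := by simpa using hder
    simpa using h0.comp_const_add r 0
  have hprod : HasDerivAt (fun δ => Real.exp δ • z (r + δ)) (deriv z r + z r) 0 := by
    simpa using (Real.hasDerivAt_exp 0).fun_smul hshift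
  have hsub : 𝓝[>] (0 : ℝ) ≤ 𝓝[≠] 0 := nhdsGT_le_nhdsNE 0
  have h1 := (hasDerivAt_iff_tendsto_slope_zero.1 hprod).mono_left hsub
  have h2 := (hasDerivAt_iff_tendsto_slope_zero.1 (Real.hasDerivAt_exp 0)).mono_left hsub
  simp only [zero_add, add_zero, Real.exp_zero, one_smul, smul_eq_mul] at h1 h2
  have h3 := (h2.inv₀ one_ne_zero).smul h1
  rw [inv_one, one_smul] at h3
  intro η hη
  refine (H.isClosed_response η (z r)).mem_of_tendsto h3 ?_
  have hsmall : ∀ᶠ δ in 𝓝[>] (0 : ℝ), K * δ < η := by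
    have hc : Tendsto (fun δ : ℝ => K * δ) (𝓝[>] 0) (𝓝 (K * 0)) :=
      ((continuous_const.mul continuous_id).tendsto 0).mono_left nhdsWithin_le_nhds
    exact hc.eventually_lt_const (by simpa using hη)
  filter_upwards [hsmall, self_mem_nhdsWithin] with δ hδη hδ
  have hδ' : (0 : ℝ) < δ := hδ
  have hmem := H.response_mono _ _ _ hδη.le (hK r δ hδ')
  convert hmem using 1
  rw [smul_smul, mul_inv, inv_inv, mul_assoc, mul_comm _ δ⁻¹, ← mul_assoc,
    mul_inv_cancel₀ hδ'.ne', one_mul]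

/-- On long windows of logarithmic time, the time average is eventually uniformly close to a
solution of the limiting inclusion that lives in the limit set. -/
theorem eventually_exists_solution [FiniteDimensional ℝ E] (H : IsAveragedResponse X B x)
    {F : E → Set E} (hF : ∀ p b, (∀ η, 0 < η → b ∈ B η p) → b - p ∈ F p)
    {ε : ℝ} (hε : 0 < ε) (R : ℝ) :
    ∀ᶠ t in atTop, ∃ z : ℝ → E, IsInclusionSolution F X z ∧
      (∀ r, z r ∈ omegaLimitSet (timeAverage x)) ∧
      ∀ r ∈ Icc 0 R, ‖timeAverage x (t * Real.exp r) - z r‖ ≤ ε := by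
  have : CompleteSpace E := FiniteDimensional.complete ℝ E
  by_contra hcon
  have hne : (atTop ⊓ 𝓟 {t | ¬ ∃ z : ℝ → E, IsInclusionSolution F X z ∧
      (∀ r, z r ∈ omegaLimitSet (timeAverage x)) ∧
      ∀ r ∈ Icc 0 R, ‖timeAverage x (t * Real.exp r) - z r‖ ≤ ε}).NeBot :=
    frequently_mem_iff_neBot.1 (not_eventually.1 hcon)
  -- Refine the bad times to an ultrafilter; the limit of translates along it is a good curve.
  obtain ⟨U, hUle⟩ := Ultrafilter.exists_le (atTop ⊓ 𝓟 {t | ¬ ∃ z : ℝ → E,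
      IsInclusionSolution F X z ∧ (∀ r, z r ∈ omegaLimitSet (timeAverage x)) ∧
      ∀ r ∈ Icc 0 R, ‖timeAverage x (t * Real.exp r) - z r‖ ≤ ε})
  have hU : (U : Filter ℝ) ≤ atTop := hUle.trans inf_le_left
  have hbad := le_principal_iff.1 (hUle.trans inf_le_right)
  obtain ⟨z, hz⟩ := H.exists_tendsto_ultrafilter hU
  obtain ⟨D, hD0, hD⟩ := H.exists_lipschitz
  have hpos : ∀ᶠ t in (U : Filter ℝ), 0 < t := (eventually_gt_atTop 0).filter_mono hU
  have hf : ∀ t, 0 < t → ∀ r s, ‖timeAverage x (t * Real.exp r)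
      - timeAverage x (t * Real.exp s)‖ ≤ D * |r - s| := by
    intro t ht r s
    rw [← log_mul_exp_sub ht r s]
    exact hD _ _ (by positivity) (by positivity)
  have hLip : ∀ r s, ‖z r - z s‖ ≤ D * |r - s| := fun r s =>
    le_of_tendsto ((hz r).2.sub (hz s).2).norm (hpos.mono fun t ht => hf t ht r s)
  have hsol := H.isInclusionSolution hF hU (fun r => (hz r).1) hD0 hLip fun r => (hz r).2
  have hL : ∀ r, z r ∈ omegaLimitSet (timeAverage x) := fun r =>
    mem_omegaLimitSet_of_tendsto
      ((tendsto_id.atTop_mul_const (Real.exp_pos r)).mono_left hU) (hz r).2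
  have hclose := eventually_forall_norm_sub_le hD0
    (hpos.mono fun t ht r s _ _ => hf t ht r s) hLip (fun r => (hz r).2) hε R
  obtain ⟨t, ht, htbad⟩ := (hclose.and hbad).exists
  exact htbad ⟨z, hsol, hL, ht⟩

/-! ### Chains in the limit set -/

theorem omegaLimitSet_subset [CompleteSpace E] (H : IsAveragedResponse X B x) :
    omegaLimitSet (timeAverage x) ⊆ X := by
  refine (iInter_subset _ 1).trans (closure_minimal ?_ H.isCompact.isClosed)
  rintro _ ⟨t, ht, rfl⟩
  exact H.timeAverage_mem (one_pos.trans_le ht)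

/-- The time average itself runs from near `p` to near `q`; cutting that stretch into pieces of
moderate logarithmic length and replacing each piece by a nearby solution gives the chain. -/
theorem hasChain [FiniteDimensional ℝ E] (H : IsAveragedResponse X B x)
    {F : E → Set E} (hF : ∀ p b, (∀ η, 0 < η → b ∈ B η p) → b - p ∈ F p) {p q : E}
    (hp : p ∈ omegaLimitSet (timeAverage x)) (hq : q ∈ omegaLimitSet (timeAverage x))
    {ε T : ℝ} (hε : 0 < ε) (hT : 0 < T) :
    HasChain F X (omegaLimitSet (timeAverage x)) ε T p q := by
  obtain ⟨S, hS⟩ := eventually_atTop.1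
    (H.eventually_exists_solution hF (half_pos hε) (2 * (T + 1)))
  obtain ⟨a, haS, hap⟩ := exists_gt_near_of_mem_omegaLimitSet hp (half_pos hε) (max S 1)
  have ha0 : 0 < a := one_pos.trans_le ((le_max_right _ _).trans haS)
  obtain ⟨b, hab, hbq⟩ := exists_gt_near_of_mem_omegaLimitSet hq (half_pos hε)
    (a * Real.exp (T + 1))
  have hb0 : 0 < b := lt_of_lt_of_le (by positivity) hab
  -- The window `[a, b]` has logarithmic length `ℓ ≥ T + 1` and is cut into `m + 1` pieces of
  -- equal length `τ ∈ [T + 1, 2 (T + 1)]`.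
  set ℓ := Real.log (b / a) with hℓ
  have hℓT : T + 1 ≤ ℓ := by
    rw [hℓ, Real.le_log_iff_exp_le (by positivity), le_div_iff₀ ha0, mul_comm]
    exact hab
  have hbℓ : b = a * Real.exp ℓ := by
    rw [hℓ, Real.exp_log (by positivity)]; field_simp
  have hT1 : 0 < T + 1 := by linarith
  obtain ⟨m, hm⟩ : ∃ m : ℕ, ⌊ℓ / (T + 1)⌋₊ = m + 1 :=
    Nat.exists_eq_succ_of_ne_zero (Nat.floor_pos.2 ((one_le_div hT1).2 hℓT)).ne'
  have hm1 : ((m : ℝ) + 1) * (T + 1) ≤ ℓ := by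
    have := Nat.floor_le (div_nonneg (hT1.le.trans hℓT) hT1.le)
    rw [hm, le_div_iff₀ hT1] at this
    exact_mod_cast this
  have hm2 : ℓ < ((m : ℝ) + 1 + 1) * (T + 1) := by
    have := Nat.lt_floor_add_one (ℓ / (T + 1))
    rw [hm, div_lt_iff₀ hT1] at this
    exact_mod_cast this
  have hmpos : (0 : ℝ) < (m : ℝ) + 1 := by positivity
  set τ := ℓ / ((m : ℝ) + 1) with hτ
  have hτ1 : T + 1 ≤ τ := by rw [hτ, le_div_iff₀ hmpos]; linarith
  have hτ2 : τ ≤ 2 * (T + 1) := by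
    rw [hτ, div_le_iff₀ hmpos]
    nlinarith [Nat.cast_nonneg (α := ℝ) m]
  have hτ0 : 0 ≤ τ := by linarith
  have hτℓ : ((m : ℝ) + 1) * τ = ℓ := by rw [hτ]; field_simp
  have hpiece : ∀ i : Fin (m + 1), ∃ z : ℝ → E, IsInclusionSolution F X z ∧
      (∀ r, z r ∈ omegaLimitSet (timeAverage x)) ∧
      ∀ r ∈ Icc 0 (2 * (T + 1)),
        ‖timeAverage x (a * Real.exp (((i : ℕ) : ℝ) * τ + r)) - z r‖ ≤ ε / 2 := by
    intro i
    have hle : S ≤ a * Real.exp (((i : ℕ) : ℝ) * τ) := by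
      refine ((le_max_left _ _).trans haS).trans (le_mul_of_one_le_right ha0.le ?_)
      exact Real.one_le_exp (by positivity)
    obtain ⟨z, hz1, hz2, hz3⟩ := hS _ hle
    refine ⟨z, hz1, hz2, fun r hr => ?_⟩
    rw [Real.exp_add, ← mul_assoc]
    exact hz3 r hr
  choose z hz1 hz2 hz3 using hpiece
  have h0mem : (0 : ℝ) ∈ Icc 0 (2 * (T + 1)) := ⟨le_rfl, by linarith⟩
  have hτmem : τ ∈ Icc 0 (2 * (T + 1)) := ⟨hτ0, hτ2⟩
  refine ⟨m, z, fun _ => τ, hz1, fun _ => by linarith, fun i s _ => hz2 i s, fun i => ?_, ?_, ?_⟩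
  · have h1 := hz3 i.castSucc τ hτmem
    have h2 := hz3 i.succ 0 h0mem
    have he : ((i.succ : ℕ) : ℝ) * τ + 0 = ((i.castSucc : ℕ) : ℝ) * τ + τ := by
      rw [Fin.val_succ, Fin.val_castSucc]; push_cast; ring
    rw [he] at h2
    rw [norm_sub_rev] at h1
    have h3 := norm_sub_le_norm_sub_add_norm_sub (z i.castSucc τ)
      (timeAverage x (a * Real.exp (((i.castSucc : ℕ) : ℝ) * τ + τ))) (z i.succ 0)
    linarith
  · have h1 := hz3 0 0 h0mem
    simp only [Fin.val_zero, Nat.cast_zero, zero_mul, add_zero, Real.exp_zero, mul_one] at h1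
    rw [norm_sub_rev] at h1
    have h3 := norm_sub_le_norm_sub_add_norm_sub (z 0 0) (timeAverage x a) p
    linarith
  · have h1 := hz3 (Fin.last m) τ hτmem
    have he : ((Fin.last m : ℕ) : ℝ) * τ + τ = ℓ := by rw [Fin.val_last, ← hτℓ]; ring
    rw [he, ← hbℓ, norm_sub_rev] at h1
    have h3 := norm_sub_le_norm_sub_add_norm_sub (z (Fin.last m) τ) (timeAverage x b) q
    linarith

/-- The limit set of the time average of an averaged response is internally chain transitive for
any inclusion containing all exact responses minus the state. -/
theorem isInternallyChainTransitive [FiniteDimensional ℝ E] (H : IsAveragedResponse X B x)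
    {F : E → Set E} (hF : ∀ p b, (∀ η, 0 < η → b ∈ B η p) → b - p ∈ F p) :
    IsInternallyChainTransitive F X (omegaLimitSet (timeAverage x)) := by
  have : CompleteSpace E := FiniteDimensional.complete ℝ E
  refine ⟨?_, ?_, fun p hp q hq ε hε T hT => H.hasChain hF hp hq hε hT⟩
  · obtain ⟨_, z, -, hz, -⟩ := (H.eventually_exists_solution hF one_pos 0).exists
    exact ⟨z 0, hz 0⟩
  · exact H.isCompact.of_isClosed_subset (isClosed_iInter fun _ => isClosed_closure)
      H.omegaLimitSet_subset

end IsAveragedResponse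

end AveragedInclusion

/-! ### Reinforcement learning -/

section ReinforcementLearning

theorem play_mem {ι : Type*} {A : ι → Type*} [∀ k, Fintype (A k)] [∀ k, Nonempty (A k)]
    (h : ∀ k, PenaltyFunction (A k)) (y : ℝ → ∀ k, A k → ℝ) (t : ℝ) :
    play h y t ∈ strategySpace A :=
  fun k => (choiceMap_mem (h k) (y t k)).1

theorem IsReinforcementSolution.continuousOn_play {ι : Type*} [Fintype ι] [DecidableEq ι]
    {A : ι → Type*} [∀ k, Fintype (A k)] [∀ k, Nonempty (A k)] {u : ι → (∀ k, A k) → ℝ}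
    {h : ∀ k, PenaltyFunction (A k)} {y : ℝ → ∀ k, A k → ℝ}
    (hy : IsReinforcementSolution u h y) : ContinuousOn (play h y) (Ici 0) := by
  refine continuousOn_pi.2 fun k => (continuous_choiceMap (h k)).comp_continuousOn ?_
  -- It suffices to argue on each `[0, T)`, where `y` is a constant plus a primitive.
  intro t ht
  have hT : (0 : ℝ) ≤ t + 1 := le_add_of_nonneg_of_le ht zero_le_one
  have hprim := intervalIntegral.continuousOn_primitive_interval
    ((intervalIntegrable_iff').1 (hy (t + 1) hT k).1)
  rw [uIcc_of_le hT] at hprim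
  have hcont : ContinuousOn (fun s => y s k) (Icc 0 (t + 1)) :=
    (continuousOn_const.add hprim).congr fun s hs => (hy s hs.1 k).2
  refine (hcont t ⟨ht, by linarith⟩).mono_of_mem_nhdsWithin ?_
  rw [← Ici_inter_Iic]
  exact inter_mem self_mem_nhdsWithin (nhdsWithin_le_nhds (Iic_mem_nhds (by linarith)))

variable {A : Fin 2 → Type*} [∀ k, Fintype (A k)] [∀ k, Nonempty (A k)]
  {u : Fin 2 → (∀ k, A k) → ℝ} {h : ∀ k, PenaltyFunction (A k)} {y : ℝ → ∀ k, A k → ℝ}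

/-- By linearity, the accumulated payoffs are those of the time average of play. -/
theorem IsReinforcementSolution.score_eq (hy : IsReinforcementSolution u h y) {t : ℝ}
    (ht : 0 < t) (k : Fin 2) :
    y t k = y 0 k + t • payoffVector u k (timeAverage (play h y) t) := by
  have hint : IntervalIntegrable (play h y) volume 0 t :=
    (hy.continuousOn_play.mono
      (by rw [uIcc_of_le ht.le]; exact Icc_subset_Ici_self)).intervalIntegrable
  rw [(hy t ht.le k).2, ← payoffCLM_apply, ← map_smul, smul_timeAverage _ ht.ne']
  exact congrArg _ ((payoffCLM u k).intervalIntegral_comp_comm hint)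

/-- Since the penalties are bounded on the simplices and scores grow like `t`, play is a
`C / t`-best response to its own time average. -/
theorem IsReinforcementSolution.exists_play_mem_approxBestResponse
    (hy : IsReinforcementSolution u h y) :
    ∃ C : ℝ, ∀ t, 0 < t →
      play h y t ∈ approxBestResponse u (C / t) (timeAverage (play h y) t) := by
  have hbd : ∀ k, ∃ C : ℝ, ∀ z ∈ stdSimplex ℝ (A k), ‖(h k).toFun z‖ ≤ C := fun k =>
    (isCompact_stdSimplex ℝ (A k)).exists_bound_of_continuousOn (h k).continuousOn
  choose C hC using hbd
  have hC0 : ∀ k, 0 ≤ C k := fun k =>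
    (norm_nonneg _).trans (hC k _ (play_mem h y 0 k))
  refine ⟨∑ k, (2 * C k + 2 * ‖y 0 k‖), fun t ht k => ⟨play_mem h y t k, fun z hz => ?_⟩⟩
  set v := payoffVector u k (timeAverage (play h y) t) with hv
  have hx : play h y t k ∈ stdSimplex ℝ (A k) := play_mem h y t k
  have hmax : pairing (y t k) z - (h k).toFun z
      ≤ pairing (y t k) (play h y t k) - (h k).toFun (play h y t k) :=
    (choiceMap_mem (h k) (y t k)).2 z hz
  rw [hy.score_eq ht k, pairing_add_left, pairing_add_left, pairing_smul_left,
    pairing_smul_left, ← hv] at hmax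
  have h1 := abs_le.1 (hC k z hz)
  have h2 := abs_le.1 (hC k _ hx)
  have h3 := abs_le.1 (abs_pairing_le (y 0 k) hz)
  have h4 := abs_le.1 (abs_pairing_le (y 0 k) hx)
  have h5 : 2 * C k + 2 * ‖y 0 k‖ ≤ ∑ k, (2 * C k + 2 * ‖y 0 k‖) :=
    Finset.single_le_sum (f := fun k => 2 * C k + 2 * ‖y 0 k‖)
      (fun j _ => by have := hC0 j; positivity) (Finset.mem_univ k)
  rw [← sub_le_iff_le_add', le_div_iff₀ ht]
  nlinarith [h1.1, h1.2, h2.1, h2.2, h3.1, h3.2, h4.1, h4.2]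

theorem IsReinforcementSolution.isAveragedResponse (hy : IsReinforcementSolution u h y) :
    IsAveragedResponse (strategySpace A) (approxBestResponse u) (play h y) where
  isCompact := by
    have : strategySpace A = univ.pi fun k => stdSimplex ℝ (A k) := by
      ext x; simp [strategySpace]
    rw [this]
    exact isCompact_univ_pi fun k => isCompact_stdSimplex ℝ (A k)
  convex := fun _ hx _ hx' _ _ hs ht hst k =>
    convex_stdSimplex ℝ (A k) (hx k) (hx' k) hs ht hst
  convex_response := convex_approxBestResponse u
  isClosed_response := isClosed_approxBestResponse u
  response_mono := fun _ _ p hη => approxBestResponse_mono u hη p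
  exists_response_subset := exists_approxBestResponse_subset u
  continuousOn := hy.continuousOn_play
  mem := fun s _ => play_mem h y s
  exists_mem_response := hy.exists_play_mem_approxBestResponse

end ReinforcementLearning

theorem mainTheorem5 {A : Fin 2 → Type*} [∀ k, Fintype (A k)] [∀ k, Nonempty (A k)]
    (u : Fin 2 → (∀ k, A k) → ℝ) (h : ∀ k, PenaltyFunction (A k))
    (y : ℝ → ∀ k, A k → ℝ) (hy : IsReinforcementSolution u h y) :
    IsInternallyChainTransitive (bestResponseField u) (strategySpace A)
      (omegaLimitSet (timeAverage (play h y))) :=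
  hy.isAveragedResponse.isInternallyChainTransitive fun _ _ hb => sub_mem_bestResponseField u hb
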